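/- Let $M$ be a finite von Neumann algebra acting on a Hilbert space, with a faithful normal trace $\tau$ normalized by $\tau(1)=1$. Let $A\subseteq M$ be a masa (a maximal abelian self-adjoint subalgebra), and let $\mathbb{E}_A\colon M\to A$ be the unique $\tau$-preserving conditional expectation of $M$ onto $A$. For each nonzero projection $e\in M$ let $\Phi_e\colon eMe\to A$ be the map $\Phi_e(eye)=\mathbb{E}_A(eye)$, $y\in M$. Suppose that for every nonzero projection $e\in M$ the map $\Phi_e$ is not injective. Then for every $x\in A$ with $0\le x\le 1$ there exists a projection $p\in M$ such that $\mathbb{E}_A(p)=x$. Moreover, every extreme point of the convex set $\Gamma_x=\{y\in M : 0\le y\le 1,\ \mathbb{E}_A(y)=x\}$ is a projection. -/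

import Mathlib

open scoped InnerProductSpace

noncomputable section

namespace Carpenter

variable {H : Type*} [NormedAddCommGroup H] [InnerProductSpace ℂ H] [CompleteSpace H]

/-- The elements of a von Neumann algebra `M` acting on `H`, as a unital `*`-algebra with the
operator norm and the usual order of operators. -/
abbrev Elt (M : VonNeumannAlgebra H) : Type _ := M.toStarSubalgebra

variable {M : VonNeumannAlgebra H}

/-- Weak-`*` (that is, ultraweak) continuity of a linear functional on `M`: it has the form
`x ↦ ∑ₙ ⟨ηₙ, x ξₙ⟩` with `∑ₙ ‖ξₙ‖²` and `∑ₙ ‖ηₙ‖²` finite, so it belongs to the predual of `M`. -/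
def IsNormalFunctional (φ : Elt M →ₗ[ℂ] ℂ) : Prop :=
  ∃ ξ η : ℕ → H, Summable (fun n => ‖ξ n‖ ^ 2) ∧ Summable (fun n => ‖η n‖ ^ 2) ∧
    ∀ x : Elt M, HasSum (fun n => ⟪η n, (x : H →L[ℂ] H) (ξ n)⟫_ℂ) (φ x)

open scoped ComplexOrder in
/-- `τ` is a faithful normal normalized trace on `M`; a von Neumann algebra with such a trace
is finite. -/
structure IsFaithfulNormalTrace (τ : Elt M →ₗ[ℂ] ℂ) : Prop where
  map_one : τ 1 = 1
  nonneg : ∀ x, 0 ≤ x → 0 ≤ τ x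
  trace : ∀ x y, τ (x * y) = τ (y * x)
  faithful : ∀ x, 0 ≤ x → τ x = 0 → x = 0
  normal : IsNormalFunctional τ

/-- `A` is a masa in `M`: maximal among the abelian self-adjoint subalgebras of `M` (no closedness
is imposed: maximality forces `A = A' ∩ M`, so `A` is a von Neumann subalgebra). -/
def IsMasa (A : StarSubalgebra ℂ (Elt M)) : Prop :=
  Maximal (fun B : StarSubalgebra ℂ (Elt M) => ∀ x ∈ B, ∀ y ∈ B, x * y = y * x) A

/-- `E` is a `τ`-preserving conditional expectation of `M` onto `A`: a positive `A`-bimodule map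
that fixes every element of `A` and preserves `τ`. -/
structure IsTraceCondExp (τ : Elt M →ₗ[ℂ] ℂ) (A : StarSubalgebra ℂ (Elt M))
    (E : Elt M →ₗ[ℂ] A) : Prop where
  nonneg : ∀ x, 0 ≤ x → 0 ≤ E x
  map_coe : ∀ a : A, E a = a
  bimodule : ∀ (a b : A) (x : Elt M), E (a * x * b) = a * E x * b
  trace : ∀ x, τ (E x) = τ x

/-- The conditional expectation `𝔼_A` of `M` onto `A`: the `τ`-preserving one. For a faithful
normal trace `τ` and a masa `A` there is exactly one. -/
def condExp (τ : Elt M →ₗ[ℂ] ℂ) (A : StarSubalgebra ℂ (Elt M)) : Elt M →ₗ[ℂ] A :=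
  Classical.epsilon (IsTraceCondExp τ A)

/-- The corner `eMe = {e x e : x ∈ M}`. -/
def corner (e : Elt M) : Submodule ℂ (Elt M) :=
  LinearMap.range (LinearMap.mulLeft ℂ e ∘ₗ LinearMap.mulRight ℂ e)

/-- The map `Φ_e : eMe → A`, `e x e ↦ 𝔼_A(e x e)`. -/
def cornerMap (τ : Elt M →ₗ[ℂ] ℂ) (A : StarSubalgebra ℂ (Elt M)) (e : Elt M) :
    corner e →ₗ[ℂ] A :=
  condExp τ A ∘ₗ (corner e).subtype

/-- The convex set `Γ_x = {y ∈ M : 0 ≤ y ≤ 1, 𝔼_A(y) = x}`. -/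
def fiber (τ : Elt M →ₗ[ℂ] ℂ) (A : StarSubalgebra ℂ (Elt M)) (x : A) : Set (Elt M) :=
  {y | 0 ≤ y ∧ y ≤ 1 ∧ condExp τ A y = x}

end Carpenter

/-!
The projection `p` is found as an extreme point of `Γ_x`. If `y ∈ Γ_x` is not a projection, then
`y (1 - y)` dominates a positive multiple of a nonzero projection `e`. As `Φ_e` is not injective,
`eMe` contains a nonzero self-adjoint `z` in the kernel of `𝔼_A`, and for small `t > 0` both
`y + t z` and `y - t z` lie in `Γ_x`, so `y` is not extreme. Extreme points exist by Krein–Milman,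
`Γ_x` being compact in the weak operator topology.

The same compactness yields `𝔼_A`: among the effects that pair with `A` under `τ` as a given effect
does, one minimises `‖y‖₂`. By strict convexity the minimiser is unique, hence fixed under
conjugation by the unitaries of `A`, hence in the masa `A`.
-/

noncomputable section

namespace Carpenter

open scoped ComplexOrder
open ContinuousLinearMapWOT Topology

section

variable {𝕜 E F : Type*} [RCLike 𝕜] [NormedAddCommGroup E] [NormedSpace 𝕜 E]
  [NormedAddCommGroup F] [InnerProductSpace 𝕜 F] [CompleteSpace F]

open Filter in
theorem isCompact_setOf_norm_toCLM_le (r : ℝ) :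
    IsCompact {T : E →WOT[𝕜] F | ‖T.toCLM‖ ≤ r} := by
  rw [isCompact_iff_ultrafilter_le_nhds']
  intro U hU
  obtain ⟨T₀, hT₀⟩ := U.nonempty_of_mem hU
  have hr : 0 ≤ r := (norm_nonneg _).trans hT₀
  have hlim (ξ : E) (η : F) : ∃ z : 𝕜, ‖z‖ ≤ r * ‖ξ‖ * ‖η‖ ∧
      Tendsto (fun T : E →WOT[𝕜] F => ⟪T ξ, η⟫_𝕜) U (𝓝 z) := by
    obtain ⟨z, hz, hlim⟩ := (isCompact_closedBall (0 : 𝕜) (r * ‖ξ‖ * ‖η‖)).ultrafilter_le_nhds'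
      (U.map fun T => ⟪T ξ, η⟫_𝕜) (Ultrafilter.mem_map.2 (mem_of_superset hU fun T hT =>
        mem_closedBall_zero_iff.2 <| (norm_inner_le_norm _ _).trans <| by
          gcongr
          exact T.toCLM.le_of_opNorm_le hT ξ))
    exact ⟨z, mem_closedBall_zero_iff.1 hz, hlim⟩
  choose B hB hUB using hlim
  let Bₗ : E →ₗ⋆[𝕜] F →ₗ[𝕜] 𝕜 := LinearMap.mk₂'ₛₗ _ _ B
    (fun ξ ξ' η => tendsto_nhds_unique (hUB _ η) <| by
      simpa only [map_add, inner_add_left] using (hUB ξ η).add (hUB ξ' η))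
    (fun c ξ η => tendsto_nhds_unique (hUB _ η) <| by
      simpa only [map_smul, inner_smul_left, smul_eq_mul] using (hUB ξ η).const_mul _)
    (fun ξ η η' => tendsto_nhds_unique (hUB ξ _) <| by
      simpa only [inner_add_right] using (hUB ξ η).add (hUB ξ η'))
    (fun c ξ η => tendsto_nhds_unique (hUB ξ _) <| by
      simpa only [inner_smul_right, smul_eq_mul, RingHom.id_apply] using (hUB ξ η).const_mul c)
  let T : E →L[𝕜] F :=
    (InnerProductSpace.toDual 𝕜 F).symm.toContinuousLinearEquiv.toContinuousLinearMap ∘SL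
       Bₗ.mkContinuous₂ r hB
  have hT (ξ : E) (η : F) : ⟪T ξ, η⟫_𝕜 = B ξ η := InnerProductSpace.toDual_symm_apply
  refine ⟨.ofCLM T, T.opNorm_le_bound hr fun ξ => ?_, ?_⟩
  · refine ((InnerProductSpace.toDual 𝕜 F).symm.norm_map _).trans_le ?_
    exact ContinuousLinearMap.opNorm_le_bound _ (by positivity) (hB ξ)
  · refine ContinuousLinearMapWOT.le_nhds_iff_forall_inner_apply_le_nhds.2 fun ξ η => ?_
    have := (hUB ξ η).star
    simp only [← hT, RCLike.star_def, inner_conj_symm] at this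
    exact this

end

variable {H : Type*} [NormedAddCommGroup H] [InnerProductSpace ℂ H]

lemma nonneg_iff_forall_inner (T : H →L[ℂ] H) : 0 ≤ T ↔ ∀ ξ, 0 ≤ ⟪ξ, T ξ⟫_ℂ := by
  rw [ContinuousLinearMap.nonneg_iff_isPositive, ContinuousLinearMap.isPositive_iff_complex]
  refine forall_congr' fun ξ => ?_
  rw [← inner_conj_symm ξ, starRingEnd_apply, star_nonneg_iff, Complex.nonneg_iff]
  simp [Complex.ext_iff, and_comm, eq_comm]

variable [CompleteSpace H] {M : VonNeumannAlgebra H}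

lemma mem_of_forall_commute {T : H →L[ℂ] H} (h : ∀ S ∈ M.commutant, Commute S T) : T ∈ M := by
  rw [← M.commutant_commutant, VonNeumannAlgebra.mem_commutant_iff]
  exact fun S hS => h S hS

lemma commute_of_mem_commutant {S : H →L[ℂ] H} (hS : S ∈ M.commutant) (x : Elt M) :
    Commute S (x : H →L[ℂ] H) :=
  (VonNeumannAlgebra.mem_commutant_iff.1 hS x x.2).symm

scoped instance : IsClosed (M.toStarSubalgebra : Set (H →L[ℂ] H)) := by
  rw [VonNeumannAlgebra.coe_toStarSubalgebra, ← M.centralizer_centralizer]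
  exact Set.isClosed_centralizer _

scoped instance : CStarAlgebra (Elt M) := StarSubalgebra.cstarAlgebra M.toStarSubalgebra

lemma exists_eq_star_mul_self {x : Elt M} (hx : 0 ≤ x) : ∃ s : Elt M, x = star s * s := by
  have hx' : 0 ≤ (x : H →L[ℂ] H) := hx
  have hs : CFC.sqrt (x : H →L[ℂ] H) ∈ M := mem_of_forall_commute fun S hS =>
    ((commute_of_mem_commutant hS x).symm.cfcₙ_nnreal _).symm
  refine ⟨⟨_, hs⟩, Subtype.ext ?_⟩
  change (x : H →L[ℂ] H) = star (CFC.sqrt (x : H →L[ℂ] H)) * CFC.sqrt (x : H →L[ℂ] H)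
  rw [(CFC.sqrt_nonneg (x : H →L[ℂ] H)).isSelfAdjoint.star_eq, CFC.sqrt_mul_sqrt_self _ hx']

scoped instance : StarOrderedRing (Elt M) :=
  .of_nonneg_iff' (fun h z => add_le_add_right (α := H →L[ℂ] H) h z) fun x =>
    ⟨exists_eq_star_mul_self, fun ⟨s, hs⟩ =>
      show 0 ≤ (x : H →L[ℂ] H) from hs ▸ star_mul_self_nonneg (s : H →L[ℂ] H)⟩

lemma exists_isStarProjection_ker (a : Elt M) :
    ∃ e : Elt M, IsStarProjection e ∧ a * e = 0 ∧ ∀ b, a * b = 0 → e * b = b := by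
  let K : Submodule ℂ H := (a : H →L[ℂ] H).ker
  have : CompleteSpace K := (a : H →L[ℂ] H).isClosed_ker.completeSpace_coe
  have hK : K.starProjection ∈ M := by
    refine (VonNeumannAlgebra.IsStarProjection.mem_iff isStarProjection_starProjection M).2
      fun S hS => ?_
    rw [Submodule.range_starProjection, Module.End.mem_invtSubmodule]
    intro ξ (hξ : (a : H →L[ℂ] H) ξ = 0)
    have := congr($(commute_of_mem_commutant hS a) ξ)
    change S ((a : H →L[ℂ] H) ξ) = (a : H →L[ℂ] H) (S ξ) at this
    change (a : H →L[ℂ] H) (S ξ) = 0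
    rw [← this, hξ, map_zero]
  refine ⟨⟨_, hK⟩, ⟨Subtype.ext isStarProjection_starProjection.isIdempotentElem,
    Subtype.ext isStarProjection_starProjection.isSelfAdjoint⟩, Subtype.ext ?_,
    fun b hb => Subtype.ext ?_⟩
  · ext ξ
    exact K.starProjection_apply_mem ξ
  · ext ξ
    exact K.starProjection_eq_self_iff.2 congr(($hb : H →L[ℂ] H) ξ)

lemma exists_smul_isStarProjection_le {c : Elt M} (h0 : 0 ≤ c) (hc : c ≠ 0) :
    ∃ e : Elt M, IsStarProjection e ∧ e ≠ 0 ∧ ∃ ε : ℝ, 0 < ε ∧ ε • e ≤ c := by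
  obtain ⟨ε, hε, hlt⟩ : ∃ ε : ℝ, 0 < ε ∧ ε < ‖c‖ := exists_between (norm_pos_iff.2 hc)
  let d : Elt M := c - algebraMap ℝ (Elt M) ε
  have hdec : c = d⁺ - d⁻ + ε • 1 := by
    rw [CFC.posPart_sub_negPart d, ← Algebra.algebraMap_eq_smul_one, sub_add_cancel]
  have hd : IsSelfAdjoint d := h0.isSelfAdjoint.sub (.algebraMap _ (.all ε))
  -- the kernel projection of `(c - ε)⁻` is the spectral projection of `c` for `[ε, ∞)`
  obtain ⟨e, he, hne, hker⟩ := exists_isStarProjection_ker d⁻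
  have hep : e * d⁺ = d⁺ := hker _ (CFC.negPart_mul_posPart d)
  have hpe : d⁺ * e = d⁺ := by
    simpa [he.isSelfAdjoint.star_eq, (CFC.posPart_nonneg d).isSelfAdjoint.star_eq] using
      congr(star $hep)
  have hen : e * d⁻ = 0 := by
    simpa [he.isSelfAdjoint.star_eq, (CFC.negPart_nonneg d).isSelfAdjoint.star_eq] using
      congr(star $hne)
  refine ⟨e, he, ?_, ε, hε, sub_nonneg.1 ?_⟩
  · rintro rfl
    have hd0 : d⁺ = 0 := by simpa using hep.symm
    refine hlt.not_ge ((CStarAlgebra.norm_le_iff_le_algebraMap c hε.le).2 (sub_nonpos.1 ?_))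
    exact (CFC.posPart_eq_zero_iff d).1 hd0
  · have hsum : c - ε • e = d⁺ + (1 - e) * c * (1 - e) := by
      have hee : e * e = e := he.isIdempotentElem
      rw [hdec]
      simp only [mul_add, mul_sub, add_mul, sub_mul, one_mul, mul_one, hep, hpe, hen, hne, hee,
        smul_mul_assoc, mul_smul_comm, zero_mul, smul_sub]
      abel
    rw [hsum]
    exact add_nonneg (CFC.posPart_nonneg d) (he.one_sub.isSelfAdjoint.conjugate_nonneg h0)

lemma exists_isStarProjection_smul_le {y : Elt M} (h0 : 0 ≤ y) (h1 : y ≤ 1)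
    (hy : ¬ IsStarProjection y) :
    ∃ e : Elt M, IsStarProjection e ∧ e ≠ 0 ∧ ∃ ε : ℝ, 0 < ε ∧ ε • e ≤ y ∧ ε • e ≤ 1 - y := by
  have hsa : IsSelfAdjoint y := h0.isSelfAdjoint
  have hc : y - y * y ≠ 0 := fun h => hy ⟨(sub_eq_zero.1 h).symm, hsa⟩
  have hc0 : 0 ≤ y - y * y := by
    simpa [pow_two] using CStarAlgebra.pow_antitone h0 h1 one_le_two
  obtain ⟨e, he, he0, ε, hε, hle⟩ := exists_smul_isStarProjection_le hc0 hc
  refine ⟨e, he, he0, ε, hε, hle.trans ?_, hle.trans ?_⟩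
  · exact sub_le_self _ hsa.mul_self_nonneg
  · have : 1 - y - (y - y * y) = (1 - y) * (1 - y) := by noncomm_ring
    rw [← sub_nonneg, this]
    exact ((IsSelfAdjoint.one _).sub hsa).mul_self_nonneg

lemma mem_corner_iff {e : Elt M} (he : IsStarProjection e) {z : Elt M} :
    z ∈ corner e ↔ e * z * e = z := by
  have hee : e * e = e := he.isIdempotentElem
  refine ⟨?_, fun h => ⟨z, by simpa [mul_assoc] using h⟩⟩
  rintro ⟨y, rfl⟩
  change e * (e * (y * e)) * e = e * (y * e)
  simp only [mul_assoc, hee]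
  rw [← mul_assoc e e, hee]

lemma star_mem_corner {e z : Elt M} (he : IsStarProjection e) (hz : z ∈ corner e) :
    star z ∈ corner e := by
  rw [mem_corner_iff he] at hz ⊢
  simpa [he.isSelfAdjoint.star_eq, mul_assoc] using congr(star $hz)

lemma exists_isSelfAdjoint_mem {A : Type*} [AddCommGroup A] [Module ℂ A] [StarAddMonoid A]
    [StarModule ℂ A] {p : Submodule ℂ A} (hstar : ∀ z ∈ p, star z ∈ p) (hp : p ≠ ⊥) :
    ∃ z ∈ p, IsSelfAdjoint z ∧ z ≠ 0 := by
  obtain ⟨z, hz, hz0⟩ := p.exists_mem_ne_zero_of_ne_bot hp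
  by_cases hre : (realPart z : A) = 0
  · refine ⟨imaginaryPart z, ?_, (imaginaryPart z).2, fun him => hz0 ?_⟩
    · rw [imaginaryPart_apply_coe]
      exact p.smul_mem _ (p.smul_of_tower_mem _ (p.sub_mem hz (hstar z hz)))
    · rw [← realPart_add_I_smul_imaginaryPart z, hre, him, smul_zero, add_zero]
  · refine ⟨realPart z, ?_, (realPart z).2, hre⟩
    rw [realPart_apply_coe]
    exact p.smul_of_tower_mem _ (p.add_mem hz (hstar z hz))

lemma le_norm_smul_of_mem_corner {e z : Elt M} (he : IsStarProjection e)
    (hz : IsSelfAdjoint z) (h : z ∈ corner e) : z ≤ ‖z‖ • e := by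
  have hee : e * e = e := he.isIdempotentElem
  have := he.isSelfAdjoint.conjugate_le_conjugate hz.le_algebraMap_norm_self
  rwa [(mem_corner_iff he).1 h, Algebra.algebraMap_eq_smul_one, mul_smul_comm, smul_mul_assoc,
    mul_one, hee] at this

lemma eq_zero_of_add_mem_of_sub_mem {E : Type*} [AddCommGroup E] [Module ℝ E] {s : Set E}
    {y w : E} (hy : y ∈ s.extremePoints ℝ) (hadd : y + w ∈ s) (hsub : y - w ∈ s) : w = 0 := by
  have h := hy.2 hadd hsub ⟨2⁻¹, 2⁻¹, by norm_num, by norm_num, by norm_num, by module⟩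
  simpa using h

theorem isStarProjection_of_mem_extremePoints {V : Type*} [AddCommGroup V] [Module ℂ V]
    {F : Elt M →ₗ[ℂ] V} (hstar : ∀ z ∈ F.ker, star z ∈ F.ker)
    (hF : ∀ e : Elt M, IsStarProjection e → e ≠ 0 → ¬ Disjoint (corner e) F.ker)
    {x : V} {y : Elt M} (hy : y ∈ {y : Elt M | 0 ≤ y ∧ y ≤ 1 ∧ F y = x}.extremePoints ℝ) :
    IsStarProjection y := by
  obtain ⟨h0, h1, hx⟩ := hy.1
  by_contra hproj
  obtain ⟨e, he, he0, ε, hε, hle, hle'⟩ := exists_isStarProjection_smul_le h0 h1 hproj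
  obtain ⟨z, ⟨hze, hzF⟩, hzsa, hz0⟩ : ∃ z ∈ corner e ⊓ F.ker, IsSelfAdjoint z ∧ z ≠ 0 :=
    exists_isSelfAdjoint_mem
      (fun z hz => ⟨star_mem_corner he hz.1, hstar z hz.2⟩)
      fun h => hF e he he0 (disjoint_iff.2 h)
  have hz0' : 0 < ‖z‖ := norm_pos_iff.2 hz0
  obtain ⟨w, hwF, hw0, hwe, hwe'⟩ : ∃ w, F w = 0 ∧ w ≠ 0 ∧ w ≤ ε • e ∧ -w ≤ ε • e := by
    have hscale : ε • e = (ε / ‖z‖) • ‖z‖ • e := by rw [smul_smul, div_mul_cancel₀ _ hz0'.ne']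
    refine ⟨(ε / ‖z‖) • z, ?_, smul_ne_zero (div_pos hε hz0').ne' hz0, ?_, ?_⟩
    · exact F.ker.smul_of_tower_mem _ hzF
    · rw [hscale]
      exact smul_le_smul_of_nonneg_left (le_norm_smul_of_mem_corner he hzsa hze) (by positivity)
    · rw [hscale, ← smul_neg, ← norm_neg z]
      exact smul_le_smul_of_nonneg_left
        (le_norm_smul_of_mem_corner he hzsa.neg ((corner e).neg_mem hze)) (by positivity)
  refine hw0 (eq_zero_of_add_mem_of_sub_mem hy ⟨?_, ?_, ?_⟩ ⟨?_, ?_, ?_⟩)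
  · exact neg_le_iff_add_nonneg.1 (hwe'.trans hle)
  · exact le_sub_iff_add_le'.1 (hwe.trans hle')
  · rw [map_add, hwF, add_zero, hx]
  · exact sub_nonneg.2 (hwe.trans hle)
  · rw [sub_eq_add_neg]
    exact le_sub_iff_add_le'.1 (hwe'.trans hle')
  · rw [map_sub, hwF, sub_zero, hx]

lemma isClosed_setOf_nonneg_toCLM : IsClosed {T : H →WOT[ℂ] H | 0 ≤ T.toCLM} := by
  simp only [nonneg_iff_forall_inner, Set.ofPred_forall]
  exact isClosed_iInter fun ξ => isClosed_Ici.preimage (continuous_inner_apply continuous_id ξ ξ)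

lemma isClosed_setOf_toCLM_mem (M : VonNeumannAlgebra H) :
    IsClosed {T : H →WOT[ℂ] H | T.toCLM ∈ M} := by
  convert! Set.isClosed_centralizer (toCLM ⁻¹' (M.commutant : Set (H →L[ℂ] H))) using 1
  rw [← M.commutant_commutant]
  ext T
  rw [Set.mem_ofPred_eq, VonNeumannAlgebra.mem_commutant_iff, VonNeumannAlgebra.commutant_commutant,
    Set.mem_centralizer_iff]
  exact ⟨fun h S hS => toCLM_injective (h _ hS), fun h S hS => congr(toCLM $(h (ofCLM S) hS))⟩

/-- The elements of `M` with the weak operator topology. -/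
def WeakElt (M : VonNeumannAlgebra H) : Type _ := Elt M

instance : Ring (WeakElt M) := inferInstanceAs (Ring (Elt M))

instance : PartialOrder (WeakElt M) := inferInstanceAs (PartialOrder (Elt M))

instance : IsOrderedAddMonoid (WeakElt M) := inferInstanceAs (IsOrderedAddMonoid (Elt M))

instance : Module ℝ (WeakElt M) := inferInstanceAs (Module ℝ (Elt M))

/-- The inclusion of `M` into the bounded operators, for the weak operator topologies. -/
def toWOT (M : VonNeumannAlgebra H) : WeakElt M →ₗ[ℝ] H →WOT[ℂ] H :=
  show Elt M →ₗ[ℝ] H →WOT[ℂ] H from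
    { toFun y := ofCLM y
      map_add' _ _ := rfl
      map_smul' _ _ := rfl }

lemma toWOT_injective : Function.Injective (toWOT M) :=
  fun _ _ h => Subtype.val_injective (ofCLM_injective h)

lemma range_toWOT : Set.range (toWOT M) = {T | T.toCLM ∈ M} := by
  ext T
  constructor
  · rintro ⟨y, rfl⟩
    exact Subtype.prop (show Elt M from y)
  · exact fun hT => ⟨(⟨T.toCLM, hT⟩ : Elt M), rfl⟩

instance : TopologicalSpace (WeakElt M) := .induced (toWOT M) inferInstance

instance : IsTopologicalAddGroup (WeakElt M) := topologicalAddGroup_induced (toWOT M)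

instance : ContinuousSMul ℝ (WeakElt M) := continuousSMul_induced (toWOT M)

instance : LocallyConvexSpace ℝ (WeakElt M) := .induced (toWOT M)

lemma isClosedEmbedding_toWOT (M : VonNeumannAlgebra H) : IsClosedEmbedding (toWOT M) where
  eq_induced := rfl
  injective := toWOT_injective
  isClosed_range := by
    rw [range_toWOT]
    exact isClosed_setOf_toCLM_mem M

instance : T2Space (WeakElt M) := (isClosedEmbedding_toWOT M).isEmbedding.t2Space

instance : OrderClosedTopology (WeakElt M) where
  isClosed_le' := by
    have h : IsClosed {y : WeakElt M | 0 ≤ y} :=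
      isClosed_setOf_nonneg_toCLM.preimage (isClosedEmbedding_toWOT M).continuous
    convert! h.preimage (continuous_snd.sub continuous_fst) using 1
    ext p
    exact (sub_nonneg (a := p.2) (b := p.1)).symm

theorem isCompact_Icc_zero_one : IsCompact (Set.Icc (0 : WeakElt M) 1) := by
  have hball := (isClosedEmbedding_toWOT M).isCompact_preimage (isCompact_setOf_norm_toCLM_le 1)
  exact hball.of_isClosed_subset isClosed_Icc fun y hy =>
    (CStarAlgebra.norm_le_one_iff_of_nonneg (A := Elt M) y hy.1).2 hy.2

lemma IsNormalFunctional.continuousOn {φ : Elt M →ₗ[ℂ] ℂ} (hφ : IsNormalFunctional φ) :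
    ContinuousOn (X := WeakElt M) φ (Set.Icc (0 : Elt M) 1) := by
  obtain ⟨ξ, η, hξ, hη, h⟩ := hφ
  have hsum (y : Elt M) : φ y = ∑' n, ⟪η n, toWOT M y (ξ n)⟫_ℂ := (h y).tsum_eq.symm
  have hcont (n : ℕ) : Continuous fun y : WeakElt M => ⟪η n, toWOT M y (ξ n)⟫_ℂ :=
    continuous_inner_apply (isClosedEmbedding_toWOT M).continuous _ _
  refine (continuousOn_tsum (fun n => (hcont n).continuousOn) (hη.add hξ) fun n y hy => ?_).congr
    fun y _ => hsum y
  have hy' : ‖(toWOT M y).toCLM‖ ≤ 1 :=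
    (CStarAlgebra.norm_le_one_iff_of_nonneg (A := Elt M) y hy.1).2 hy.2
  calc ‖⟪η n, toWOT M y (ξ n)⟫_ℂ‖ ≤ ‖η n‖ * (1 * ‖ξ n‖) :=
        (norm_inner_le_norm _ _).trans <| by
          gcongr
          exact (toWOT M y).toCLM.le_of_opNorm_le hy' (ξ n)
    _ ≤ ‖η n‖ ^ 2 + ‖ξ n‖ ^ 2 := by
        nlinarith [two_mul_le_add_sq ‖η n‖ ‖ξ n‖, sq_nonneg ‖η n‖, sq_nonneg ‖ξ n‖]

lemma IsNormalFunctional.comp_mulLeft {φ : Elt M →ₗ[ℂ] ℂ} (hφ : IsNormalFunctional φ)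
    (a : Elt M) : IsNormalFunctional (φ ∘ₗ LinearMap.mulLeft ℂ a) := by
  obtain ⟨ξ, η, hξ, hη, h⟩ := hφ
  refine ⟨ξ, fun n => star (a : H →L[ℂ] H) (η n), hξ, ?_, fun x => ?_⟩
  · refine .of_nonneg_of_le (fun n => sq_nonneg _) (fun n => ?_)
      (hη.mul_left (‖star (a : H →L[ℂ] H)‖ ^ 2))
    rw [← mul_pow]
    gcongr
    exact ContinuousLinearMap.le_opNorm _ _
  · simp only [ContinuousLinearMap.star_eq_adjoint, ContinuousLinearMap.adjoint_inner_left]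
    exact h (a * x)

variable {τ : Elt M →ₗ[ℂ] ℂ} {A : StarSubalgebra ℂ (Elt M)}

lemma IsMasa.mem_of_isSelfAdjoint_of_commute (hA : IsMasa A) {y : Elt M} (hy : IsSelfAdjoint y)
    (h : ∀ a ∈ A, Commute a y) : y ∈ A := by
  have hcomm : ∀ a ∈ insert y (A : Set (Elt M)), ∀ b ∈ insert y (A : Set (Elt M)),
      a * b = b * a := by
    rintro a (rfl | ha) b (rfl | hb)
    · rfl
    · exact (h b hb).symm
    · exact h a ha
    · exact hA.prop a ha b hb
  have hstar : ∀ b ∈ insert y (A : Set (Elt M)), star b ∈ insert y (A : Set (Elt M)) := by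
    rintro b (rfl | hb)
    · exact .inl hy.star_eq
    · exact .inr (star_mem (S := StarSubalgebra ℂ (Elt M)) hb)
  have hadj := StarAlgebra.isMulCommutative_adjoin ℂ hcomm fun a ha b hb =>
    hcomm a ha _ (hstar b hb)
  have hsub := StarAlgebra.subset_adjoin ℂ (insert y (A : Set (Elt M)))
  refine hA.le_of_ge (fun a ha b hb => ?_) ((Set.subset_insert _ _).trans hsub)
    (hsub (Set.mem_insert _ _))
  exact congr(($(hadj.is_comm.comm ⟨a, ha⟩ ⟨b, hb⟩)).1)

lemma IsMasa.coe_eq_centralizer (hA : IsMasa A) :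
    (A : Set (Elt M)) = Set.centralizer (A : Set (Elt M)) := by
  refine Set.Subset.antisymm (fun a ha b hb => hA.prop b hb a ha) fun y hy => ?_
  have hstar (a : Elt M) (ha : a ∈ A) : Commute a (star y) := by
    simpa [Commute, SemiconjBy] using congr(star $(hy (star a) (star_mem ha))).symm
  rw [← realPart_add_I_smul_imaginaryPart y]
  refine add_mem (hA.mem_of_isSelfAdjoint_of_commute (realPart y).2 fun a ha => ?_)
    (SMulMemClass.smul_mem _
      (hA.mem_of_isSelfAdjoint_of_commute (imaginaryPart y).2 fun a ha => ?_))
  · rw [realPart_apply_coe]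
    exact (Commute.add_right (hy a ha) (hstar a ha)).smul_right _
  · rw [imaginaryPart_apply_coe]
    exact ((Commute.sub_right (hy a ha) (hstar a ha)).smul_right _).smul_right _

lemma IsMasa.mem_of_commute_unitary (hA : IsMasa A) {y : Elt M}
    (h : ∀ u ∈ A, u ∈ unitary (Elt M) → Commute u y) : y ∈ A := by
  have : IsClosed (A : Set (Elt M)) := hA.coe_eq_centralizer ▸ Set.isClosed_centralizer _
  let := StarSubalgebra.cstarAlgebra A
  rw [← SetLike.mem_coe, hA.coe_eq_centralizer]
  suffices ∀ a : A, Commute (a : Elt M) y from fun a ha => this ⟨a, ha⟩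
  intro a
  have ha : a ∈ Submodule.span ℂ (unitary A : Set A) :=
    CStarAlgebra.span_unitary (A := A) ▸ Submodule.mem_top
  induction ha using Submodule.span_induction with
  | mem u hu => exact h u u.2 (Unitary.map_mem A.subtype hu)
  | zero => exact Commute.zero_left y
  | add u v _ _ hu hv => exact Commute.add_left hu hv
  | smul c u _ hu => exact Commute.smul_left hu c

lemma IsFaithfulNormalTrace.map_star (hτ : IsFaithfulNormalTrace τ) (x : Elt M) :
    τ (star x) = star (τ x) :=
  StarHomClass.map_star (PositiveLinearMap.mk₀ τ hτ.nonneg) x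

lemma IsFaithfulNormalTrace.eq_zero_of_star_mul_self (hτ : IsFaithfulNormalTrace τ) {z : Elt M}
    (hz : τ (star z * z) = 0) : z = 0 :=
  CStarRing.star_mul_self_eq_zero_iff z |>.1 <| hτ.faithful _ (star_mul_self_nonneg z) hz

/-- The annihilator `{z : τ (a z) = 0 for all a ∈ A}` of `A` under the pairing given by `τ`; for a
masa it is the kernel of the conditional expectation onto `A`. -/
def annihilator (τ : Elt M →ₗ[ℂ] ℂ) (A : StarSubalgebra ℂ (Elt M)) : Submodule ℂ (Elt M) :=
  ⨅ a ∈ A, (τ ∘ₗ LinearMap.mulLeft ℂ a).ker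

lemma mem_annihilator {z : Elt M} : z ∈ annihilator τ A ↔ ∀ a ∈ A, τ (a * z) = 0 := by
  simp [annihilator]

lemma IsFaithfulNormalTrace.star_mem_annihilator (hτ : IsFaithfulNormalTrace τ) {z : Elt M}
    (hz : z ∈ annihilator τ A) : star z ∈ annihilator τ A := by
  refine mem_annihilator.2 fun a ha => ?_
  have := mem_annihilator.1 hz (star a) (star_mem ha)
  rw [hτ.trace, ← star_star a, ← star_mul, hτ.map_star, this, star_zero]

lemma IsFaithfulNormalTrace.mul_mul_mem_annihilator (hτ : IsFaithfulNormalTrace τ) {a b z : Elt M}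
    (ha : a ∈ A) (hb : b ∈ A) (hz : z ∈ annihilator τ A) : a * z * b ∈ annihilator τ A := by
  refine mem_annihilator.2 fun c hc => ?_
  rw [← mul_assoc, hτ.trace, ← mul_assoc, ← mul_assoc]
  exact mem_annihilator.1 hz _ (mul_mem (mul_mem hb hc) ha)

lemma IsFaithfulNormalTrace.disjoint_annihilator (hτ : IsFaithfulNormalTrace τ)
    (A : StarSubalgebra ℂ (Elt M)) :
    Disjoint (Subalgebra.toSubmodule A.toSubalgebra) (annihilator τ A) :=
  Submodule.disjoint_def.2 fun _ hzA hz =>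
    hτ.eq_zero_of_star_mul_self (mem_annihilator.1 hz _ (star_mem (s := A) hzA))

/-- The effects `y` of `M` that pair with `A` like `x` does; for a masa `A` and `x ∈ A` this is the
set `Γ_x`. -/
def traceFiber (τ : Elt M →ₗ[ℂ] ℂ) (A : StarSubalgebra ℂ (Elt M)) (x : Elt M) : Set (Elt M) :=
  {y | y ∈ Set.Icc 0 1 ∧ y - x ∈ annihilator τ A}

lemma self_mem_traceFiber {x : Elt M} (hx : x ∈ Set.Icc 0 1) : x ∈ traceFiber τ A x :=
  ⟨hx, by simp⟩

lemma convex_traceFiber (x : Elt M) : Convex ℝ (traceFiber τ A x) := by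
  intro y hy z hz a b ha hb hab
  refine ⟨convex_Icc 0 1 hy.1 hz.1 ha hb hab, ?_⟩
  have : a • y + b • z - x = a • (y - x) + b • (z - x) := by
    rw [smul_sub, smul_sub, sub_add_sub_comm, ← add_smul, hab, one_smul]
  rw [this]
  exact add_mem ((annihilator τ A).smul_of_tower_mem a hy.2)
    ((annihilator τ A).smul_of_tower_mem b hz.2)

lemma IsFaithfulNormalTrace.isCompact_traceFiber (hτ : IsFaithfulNormalTrace τ)
    (A : StarSubalgebra ℂ (Elt M)) (x : Elt M) :
    IsCompact (X := WeakElt M) (traceFiber τ A x) := by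
  have hfiber : traceFiber τ A x = ⋂ a : A, Set.Icc (0 : Elt M) 1 ∩
      (τ ∘ₗ LinearMap.mulLeft ℂ (a : Elt M)) ⁻¹' {τ (a * x)} := by
    ext y
    simp [traceFiber, mem_annihilator, ← Set.inter_iInter, mul_sub, sub_eq_zero]
  rw [hfiber]
  refine isCompact_Icc_zero_one.of_isClosed_subset ?_
    (Set.iInter_subset_of_subset 1 Set.inter_subset_left)
  exact isClosed_iInter fun a =>
    (hτ.normal.comp_mulLeft a).continuousOn.preimage_isClosed_of_isClosed (α := WeakElt M)
      isCompact_Icc_zero_one.isClosed isClosed_singleton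

/-- The squared Hilbert–Schmidt norm `‖y‖₂² = τ (y* y)` attached to `τ`. -/
def normSq (τ : Elt M →ₗ[ℂ] ℂ) (y : Elt M) : ℝ :=
  (τ (star y * y)).re

lemma IsFaithfulNormalTrace.normSq_pos (hτ : IsFaithfulNormalTrace τ) {y : Elt M} (hy : y ≠ 0) :
    0 < normSq τ y := by
  have h := hτ.nonneg _ (star_mul_self_nonneg y)
  exact (Complex.pos_iff.1 (h.lt_of_ne' fun h0 => hy (hτ.eq_zero_of_star_mul_self h0))).1

lemma IsFaithfulNormalTrace.strictConvexOn_normSq (hτ : IsFaithfulNormalTrace τ)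
    {s : Set (Elt M)} (hs : Convex ℝ s) : StrictConvexOn ℝ s (normSq τ) := by
  refine ⟨hs, fun y _ z _ hyz a b ha hb hab => ?_⟩
  have key : normSq τ (a • y + b • z) + a * b * normSq τ (y - z) =
      a * normSq τ y + b * normSq τ z := by
    obtain rfl : b = 1 - a := by linarith
    simp only [normSq, star_add, star_sub, star_smul, star_trivial, add_mul, mul_add, sub_mul,
      mul_sub, smul_mul_smul_comm, map_add, map_sub, LinearMap.map_smul_of_tower, Complex.add_re,
      Complex.sub_re, Complex.real_smul, Complex.re_ofReal_mul]
    ring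
  have := mul_pos (mul_pos ha hb) (hτ.normSq_pos (sub_ne_zero.2 hyz))
  simp only [smul_eq_mul]
  linarith

lemma IsFaithfulNormalTrace.two_mul_re_sub_normSq_le (hτ : IsFaithfulNormalTrace τ)
    (y z : Elt M) : 2 * (τ (star y * z)).re - normSq τ y ≤ normSq τ z := by
  have hzy : (τ (star z * y)).re = (τ (star y * z)).re := by
    rw [← star_star y, ← star_mul, hτ.map_star, star_star]
    exact Complex.conj_re _
  have h := (Complex.nonneg_iff.1 (hτ.nonneg _ (star_mul_self_nonneg (z - y)))).1
  simp only [star_sub, sub_mul, mul_sub, map_sub, Complex.sub_re, hzy] at h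
  simp only [normSq]
  linarith

lemma IsFaithfulNormalTrace.lowerSemicontinuousOn_normSq (hτ : IsFaithfulNormalTrace τ) :
    LowerSemicontinuousOn (α := WeakElt M) (normSq τ) (Set.Icc (0 : Elt M) 1) := by
  intro (y : Elt M) hy r hr
  let g (z : Elt M) : ℝ := 2 * (τ (star y * z)).re - normSq τ y
  have hg : ContinuousOn (X := WeakElt M) g (Set.Icc (0 : Elt M) 1) :=
    (continuousOn_const.mul (Complex.continuous_re.comp_continuousOn
      (hτ.normal.comp_mulLeft (star y)).continuousOn)).sub continuousOn_const
  have hgy : g y = normSq τ y := by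
    simp only [g, normSq]
    ring
  filter_upwards [(hg y hy).eventually_const_lt (hr.trans_eq hgy.symm)] with z hz
  exact hz.trans_le (hτ.two_mul_re_sub_normSq_le y z)

lemma unitary_conjugate_mem_Icc {R : Type*} [Ring R] [StarRing R] [PartialOrder R]
    [StarOrderedRing R] {u y : R} (hu : u ∈ unitary R) (hy : y ∈ Set.Icc (0 : R) 1) :
    u * y * star u ∈ Set.Icc (0 : R) 1 := by
  have h := star_right_conjugate_le_conjugate hy.2 u
  rw [mul_one, Unitary.mul_star_self_of_mem hu] at h
  exact ⟨star_right_conjugate_nonneg hy.1 u, h⟩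

lemma IsFaithfulNormalTrace.normSq_unitary_conjugate (hτ : IsFaithfulNormalTrace τ) {u : Elt M}
    (hu : u ∈ unitary (Elt M)) (y : Elt M) : normSq τ (u * y * star u) = normSq τ y := by
  have h : star (u * y * star u) * (u * y * star u) = u * (star y * y) * star u := by
    simp only [star_mul, star_star, mul_assoc]
    rw [← mul_assoc (star u) u, Unitary.star_mul_self_of_mem hu, one_mul]
  rw [normSq, normSq, h, hτ.trace, ← mul_assoc, Unitary.star_mul_self_of_mem hu, one_mul]

lemma IsFaithfulNormalTrace.unitary_conjugate_mem_traceFiber (hτ : IsFaithfulNormalTrace τ)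
    (hA : IsMasa A) {u x y : Elt M} (huA : u ∈ A) (hu : u ∈ unitary (Elt M))
    (hy : y ∈ traceFiber τ A x) : u * y * star u ∈ traceFiber τ A x := by
  refine ⟨unitary_conjugate_mem_Icc hu hy.1, mem_annihilator.2 fun a ha => ?_⟩
  rw [← mem_annihilator.1 hy.2 a ha, mul_sub, mul_sub, map_sub, map_sub, sub_left_inj]
  rw [← mul_assoc, hτ.trace, ← mul_assoc, ← mul_assoc, mul_assoc (star u), hA.prop a ha u huA,
    ← mul_assoc, Unitary.star_mul_self_of_mem hu, one_mul]

theorem IsFaithfulNormalTrace.exists_mem_traceFiber (hτ : IsFaithfulNormalTrace τ) (hA : IsMasa A)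
    {x : Elt M} (hx : x ∈ Set.Icc 0 1) : ∃ y ∈ A, y ∈ traceFiber τ A x := by
  obtain ⟨y, hy, hmin⟩ : ∃ y ∈ traceFiber τ A x, IsMinOn (normSq τ) (traceFiber τ A x) y :=
    LowerSemicontinuousOn.exists_isMinOn (α := WeakElt M) ⟨x, self_mem_traceFiber hx⟩
      (hτ.isCompact_traceFiber A x) (hτ.lowerSemicontinuousOn_normSq.mono fun _ h => h.1)
  refine ⟨y, hA.mem_of_commute_unitary fun u huA hu => ?_, hy⟩
  have hz := hτ.unitary_conjugate_mem_traceFiber hA huA hu hy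
  have hzmin : IsMinOn (normSq τ) (traceFiber τ A x) (u * y * star u) := fun w hw =>
    (hτ.normSq_unitary_conjugate hu y).trans_le (hmin hw)
  have huy : u * y * star u = y :=
    (hτ.strictConvexOn_normSq (convex_traceFiber x)).eq_of_isMinOn hzmin hmin hz hy
  calc u * y = u * y * star u * u := by
        rw [mul_assoc, Unitary.star_mul_self_of_mem hu, mul_one]
    _ = y * u := by rw [huy]

lemma exists_eq_smul_of_nonneg {B : Type*} [CStarAlgebra B] [PartialOrder B] [StarOrderedRing B]
    {x : B} (hx : 0 ≤ x) : ∃ r : ℝ, 0 ≤ r ∧ ∃ e ∈ Set.Icc (0 : B) 1, x = r • e := by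
  refine ⟨‖x‖, norm_nonneg x, ‖x‖⁻¹ • x, ?_, ?_⟩
  · have h : 0 ≤ ‖x‖⁻¹ • x := smul_nonneg (by positivity) hx
    refine ⟨h, (CStarAlgebra.norm_le_one_iff_of_nonneg _ h).1 ?_⟩
    rw [norm_smul, norm_inv, norm_norm]
    exact inv_mul_le_one
  · obtain rfl | hx0 := eq_or_ne x 0
    · simp
    · rw [smul_inv_smul₀ (norm_ne_zero_iff.2 hx0)]

lemma IsFaithfulNormalTrace.exists_nonneg_sub_mem_annihilator (hτ : IsFaithfulNormalTrace τ)
    (hA : IsMasa A) {x : Elt M} (hx : 0 ≤ x) : ∃ y ∈ A, 0 ≤ y ∧ x - y ∈ annihilator τ A := by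
  obtain ⟨r, hr, e, he, rfl⟩ := exists_eq_smul_of_nonneg hx
  obtain ⟨y, hyA, hy, hye⟩ := hτ.exists_mem_traceFiber hA he
  refine ⟨r • y, SMulMemClass.smul_mem (r : ℂ) hyA, smul_nonneg hr hy.1, ?_⟩
  rw [← smul_sub, ← neg_sub y]
  exact (annihilator τ A).smul_of_tower_mem r (neg_mem hye)

lemma IsFaithfulNormalTrace.isCompl_annihilator (hτ : IsFaithfulNormalTrace τ) (hA : IsMasa A) :
    IsCompl (Subalgebra.toSubmodule A.toSubalgebra) (annihilator τ A) := by
  refine ⟨hτ.disjoint_annihilator A, codisjoint_iff_le_sup.2 ?_⟩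
  rw [← CStarAlgebra.span_nonneg, Submodule.span_le]
  intro x hx
  obtain ⟨y, hyA, -, hy⟩ := hτ.exists_nonneg_sub_mem_annihilator hA hx
  exact Submodule.mem_sup.2 ⟨y, hyA, x - y, hy, add_sub_cancel y x⟩

theorem IsFaithfulNormalTrace.exists_isTraceCondExp (hτ : IsFaithfulNormalTrace τ)
    (hA : IsMasa A) : ∃ E : Elt M →ₗ[ℂ] A, IsTraceCondExp τ A E := by
  let E : Elt M →ₗ[ℂ] A := Submodule.projectionOnto _ _ (hτ.isCompl_annihilator hA)
  have hcoe (a : A) : E a = a := Submodule.projectionOnto_apply_left (hτ.isCompl_annihilator hA) a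
  have hE (x : Elt M) (a : A) : E x = a ↔ x - a ∈ annihilator τ A := by
    rw [← sub_eq_zero, ← hcoe a, ← map_sub, hcoe]
    exact Submodule.projectionOnto_apply_eq_zero_iff _
  refine ⟨E, fun x hx => ?_, hcoe, fun a b x => (hE _ _).2 ?_, fun x => ?_⟩
  · obtain ⟨y, hyA, hy0, hy⟩ := hτ.exists_nonneg_sub_mem_annihilator hA hx
    rw [(hE x ⟨y, hyA⟩).2 hy]
    exact hy0
  · have := hτ.mul_mul_mem_annihilator a.2 b.2 ((hE x (E x)).1 rfl)
    rwa [mul_sub, sub_mul] at this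
  · have := mem_annihilator.1 ((hE x (E x)).1 rfl) 1 (one_mem A)
    rwa [one_mul, map_sub, sub_eq_zero, eq_comm] at this

theorem IsFaithfulNormalTrace.isTraceCondExp_condExp (hτ : IsFaithfulNormalTrace τ)
    (hA : IsMasa A) : IsTraceCondExp τ A (condExp τ A) :=
  Classical.epsilon_spec (hτ.exists_isTraceCondExp hA)

lemma IsTraceCondExp.ker_eq {E : Elt M →ₗ[ℂ] A} (hE : IsTraceCondExp τ A E)
    (hτ : IsFaithfulNormalTrace τ) : E.ker = annihilator τ A := by
  have hle : E.ker ≤ annihilator τ A := fun z hz => mem_annihilator.2 fun a ha => by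
    have := hE.bimodule ⟨a, ha⟩ 1 z
    simp only [OneMemClass.coe_one, mul_one, LinearMap.mem_ker.1 hz, mul_zero] at this
    rw [← hE.trace, this, ZeroMemClass.coe_zero, map_zero]
  refine hle.antisymm fun z hz => ?_
  have hEz : (E z : Elt M) ∈ annihilator τ A := by
    rw [← sub_sub_cancel z (E z : Elt M)]
    exact sub_mem hz (hle (by simp [hE.map_coe]))
  exact Subtype.ext (Submodule.disjoint_def.1 (hτ.disjoint_annihilator A) _ (E z).2 hEz)

lemma IsTraceCondExp.star_mem_ker {E : Elt M →ₗ[ℂ] A} (hE : IsTraceCondExp τ A E)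
    (hτ : IsFaithfulNormalTrace τ) {z : Elt M} (hz : z ∈ E.ker) : star z ∈ E.ker := by
  rw [hE.ker_eq hτ] at hz ⊢
  exact hτ.star_mem_annihilator hz

lemma IsFaithfulNormalTrace.fiber_eq_traceFiber (hτ : IsFaithfulNormalTrace τ) (hA : IsMasa A)
    (x : A) : fiber τ A x = traceFiber τ A x := by
  have hE := hτ.isTraceCondExp_condExp hA
  ext y
  rw [fiber, traceFiber, Set.mem_ofPred_eq, Set.mem_ofPred_eq, Set.mem_Icc, and_assoc,
    ← hE.ker_eq hτ, LinearMap.mem_ker, map_sub, hE.map_coe, sub_eq_zero]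

theorem IsFaithfulNormalTrace.extremePoints_fiber_nonempty (hτ : IsFaithfulNormalTrace τ)
    (hA : IsMasa A) {x : A} (hx : x ∈ Set.Icc 0 1) :
    (Set.extremePoints ℝ (fiber τ A x)).Nonempty := by
  rw [hτ.fiber_eq_traceFiber hA]
  exact (hτ.isCompact_traceFiber A x).extremePoints_nonempty ⟨_, self_mem_traceFiber hx⟩

end Carpenter

end

theorem lemma2p1 {H : Type*} [NormedAddCommGroup H] [InnerProductSpace ℂ H] [CompleteSpace H]
    (M : VonNeumannAlgebra H) (τ : Carpenter.Elt M →ₗ[ℂ] ℂ)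
    (hτ : Carpenter.IsFaithfulNormalTrace τ)
    (A : StarSubalgebra ℂ (Carpenter.Elt M)) (hA : Carpenter.IsMasa A)
    (hΦ : ∀ e : Carpenter.Elt M, IsStarProjection e → e ≠ 0 →
      ¬ Function.Injective (Carpenter.cornerMap τ A e))
    (x : A) (hx0 : 0 ≤ x) (hx1 : x ≤ 1) :
    (∃ p : Carpenter.Elt M, IsStarProjection p ∧ Carpenter.condExp τ A p = x) ∧
      ∀ y ∈ Set.extremePoints ℝ (Carpenter.fiber τ A x), IsStarProjection y := by
  have hE := hτ.isTraceCondExp_condExp hA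
  have hext : ∀ y ∈ Set.extremePoints ℝ (Carpenter.fiber τ A x), IsStarProjection y := fun y hy =>
    Carpenter.isStarProjection_of_mem_extremePoints (fun _ => hE.star_mem_ker hτ)
      (fun e he he0 h => hΦ e he he0 (LinearMap.injective_domRestrict_iff.2 h)) hy
  obtain ⟨p, hp⟩ := hτ.extremePoints_fiber_nonempty hA ⟨hx0, hx1⟩
  exact ⟨⟨p, hext p hp, hp.1.2.2⟩, hext⟩
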